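/- Let $d\ge 1$ and let $P$ be an arbitrary Borel probability measure on $\mathbb R^d$, with Euclidean inner product $\langle\cdot,\cdot\rangle$ and norm $\|\cdot\|$. For Borel probability measures $P,P'$ on $\mathbb R^d$ let $$d_W(P,P')=\inf_{\Pi}\int\|x-y\|\,\Pi(dx,dy)\in[0,\infty],$$ where $\Pi$ ranges over all Borel probability measures on $\mathbb R^d\times\mathbb R^d$ with first marginal $P$ and second marginal $P'$. For $\delta>0$ and $z\in\mathbb R^d$ define the robustified halfspace depth $$D_\delta(z\mid P)=\inf_{u\in\mathbb R^d:\,\|u\|=1}\ \ \sup_{P':\,d_W(P',P)\le\delta}P'\big(\{x\in\mathbb R^d:\langle u,x-z\rangle\ge 0\}\big)\in[0,1],$$ the supremum being over Borel probability measures $P'$ on $\mathbb R^d$. Then for every $\delta>0$: (P1) Isometric invariance: for every $A\in\mathbb R^{d\times d}$ with $AA^\top=I$ and all $b,z\in\mathbb R^d$, $D_\delta(Az+b\mid P_{A,b})=D_\delta(z\mid P)$, where $P_{A,b}$ is the image of $P$ under the map $x\mapsto Ax+b$. (P2) Null at infinity: $D_\delta(z\mid P)\to 0$ as $\|z\|\to\infty$.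 (P3) Convex upper level sets: for every $\alpha\in(0,1]$ the set $\{z\in\mathbb R^d: D_\delta(z\mid P)\ge\alpha\}$ is convex. -/

import Mathlib

open MeasureTheory Filter Topology
open scoped ENNReal

/-- `Q` is a joint law with first marginal `P` and second marginal `P'`. -/
def IsCoupling {E : Type*} [MeasurableSpace E] (P P' : Measure E) (Q : Measure (E × E)) : Prop :=
  Q.map Prod.fst = P ∧ Q.map Prod.snd = P'

/-- The Wasserstein distance `d_W(P, P') ∈ [0, ∞]`, with cost the Euclidean distance:
the infimum of `∫ ‖x - y‖ dQ(x, y)` over all couplings `Q` of `P` and `P'`. -/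
noncomputable def wassersteinDist {d : ℕ} (P P' : Measure (EuclideanSpace ℝ (Fin d))) : ℝ≥0∞ :=
  ⨅ (Q : Measure (EuclideanSpace ℝ (Fin d) × EuclideanSpace ℝ (Fin d))) (_ : IsCoupling P P' Q),
    ∫⁻ p, ENNReal.ofReal ‖p.1 - p.2‖ ∂Q

/-- The closed halfspace `{x : ⟨u, x - z⟩ ≥ 0}`. -/
def closedHalfspace {d : ℕ} (u z : EuclideanSpace ℝ (Fin d)) : Set (EuclideanSpace ℝ (Fin d)) :=
  {x | 0 ≤ inner ℝ u (x - z)}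

/-- The largest mass that a law `P'` with `d_W(P', P) ≤ δ` gives to the closed halfspace
`{x : ⟨u, x - z⟩ ≥ 0}`. -/
noncomputable def worstCaseMass {d : ℕ} (δ : ℝ) (P : Measure (EuclideanSpace ℝ (Fin d)))
    (u z : EuclideanSpace ℝ (Fin d)) : ℝ≥0∞ :=
  ⨆ (P' : ProbabilityMeasure (EuclideanSpace ℝ (Fin d)))
    (_ : wassersteinDist (P' : Measure (EuclideanSpace ℝ (Fin d))) P ≤ ENNReal.ofReal δ),
    (P' : Measure (EuclideanSpace ℝ (Fin d))) (closedHalfspace u z)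

/-- The robustified halfspace depth `D_δ(z | P)`: the infimum over all unit vectors `u` of the
worst-case mass. In dimension at least one it takes values in `[0, 1]`. -/
noncomputable def robustDepth {d : ℕ} (δ : ℝ) (P : Measure (EuclideanSpace ℝ (Fin d)))
    (z : EuclideanSpace ℝ (Fin d)) : ℝ≥0∞ :=
  ⨅ (u : EuclideanSpace ℝ (Fin d)) (_ : ‖u‖ = 1), worstCaseMass δ P u z

theorem robustDepth_le_one {d : ℕ} (hd : 1 ≤ d) (δ : ℝ)
    (P : Measure (EuclideanSpace ℝ (Fin d))) (z : EuclideanSpace ℝ (Fin d)) :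
    robustDepth δ P z ≤ 1 := by
  obtain ⟨u, hu⟩ : ∃ u : EuclideanSpace ℝ (Fin d), ‖u‖ = 1 :=
    ⟨EuclideanSpace.single ⟨0, hd⟩ 1, by simp⟩
  calc robustDepth δ P z ≤ worstCaseMass δ P u z := iInf₂_le u hu
    _ ≤ 1 := iSup₂_le (fun P' _ => prob_le_one)

section Wasserstein

variable {d : ℕ}

local notation "𝔼" => EuclideanSpace ℝ (Fin d)

/-! Isometries carry couplings to couplings of equal cost and halfspaces to halfspaces, so the depth
cannot increase under them; the inverse isometry gives equality. For decay, the single direction `z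
/ ‖z‖` suffices: its halfspace lies outside the open ball of radius `‖z‖`, so mass there comes from
the tail of `P` beyond `‖z‖ / 2` or was transported at least that far, and Markov's inequality
bounds the latter. For convexity, with `u` fixed the worst-case mass is antitone in `⟨u, z⟩`, hence
quasiconcave in `z`, and infima preserve quasiconcavity. -/

theorem wassersteinDist_map_le {f : 𝔼 → 𝔼} (hf : Isometry f) (P P' : Measure 𝔼) :
    wassersteinDist (P.map f) (P'.map f) ≤ wassersteinDist P P' := by
  have hm : Measurable f := hf.continuous.measurable
  refine le_iInf₂ fun Q hQ => ?_
  refine (iInf₂_le (Q.map (Prod.map f f)) (And.intro ?fst ?snd)).trans ?cost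
  case fst =>
    rw [Measure.map_map measurable_fst (hm.prodMap hm), ← hQ.1, Measure.map_map hm measurable_fst]
    rfl
  case snd =>
    rw [Measure.map_map measurable_snd (hm.prodMap hm), ← hQ.2, Measure.map_map hm measurable_snd]
    rfl
  case cost =>
    rw [lintegral_map (by fun_prop) (hm.prodMap hm)]
    refine lintegral_mono fun p => ?_
    simp only [Prod.map_fst, Prod.map_snd, ← dist_eq_norm, hf.dist_eq, le_refl]

theorem measurableSet_closedHalfspace (u z : 𝔼) : MeasurableSet (closedHalfspace u z) :=
  measurableSet_le measurable_const (by fun_prop)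

theorem worstCaseMass_map_le (δ : ℝ) (P : Measure 𝔼) (T : 𝔼 ≃ᵃⁱ[ℝ] 𝔼) (u z : 𝔼) :
    worstCaseMass δ (P.map T) (T.linearIsometryEquiv u) (T z) ≤ worstCaseMass δ P u z := by
  have hT : Measurable T := T.continuous.measurable
  have hS : Measurable T.symm := T.symm.continuous.measurable
  refine iSup₂_le fun P' hP' => ?_
  -- A competitor `P'` for the image law is pulled back along `T.symm` to a competitor for `P`.
  refine le_trans ?_ (le_iSup₂ (P'.map hS.aemeasurable) ?_)
  · rw [ProbabilityMeasure.toMeasure_map, Measure.map_apply hS (measurableSet_closedHalfspace u z)]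
    refine measure_mono fun x hx => ?_
    have hx' : 0 ≤ inner ℝ (T.linearIsometryEquiv u) (x - T z) := hx
    show 0 ≤ inner ℝ u (T.symm x - z)
    rw [← T.linearIsometryEquiv.inner_map_map]
    have := T.map_vsub (T.symm x) z
    simp only [vsub_eq_sub, T.apply_symm_apply] at this
    rwa [this]
  · have h := wassersteinDist_map_le T.symm.isometry (P' : Measure 𝔼) (P.map T)
    rw [Measure.map_map hS hT] at h
    have hid : (T.symm ∘ T : 𝔼 → 𝔼) = id := funext T.symm_apply_apply
    rw [hid, Measure.map_id] at h
    exact h.trans hP'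

theorem robustDepth_map_le (δ : ℝ) (P : Measure 𝔼) (T : 𝔼 ≃ᵃⁱ[ℝ] 𝔼) (z : 𝔼) :
    robustDepth δ (P.map T) (T z) ≤ robustDepth δ P z :=
  le_iInf₂ fun u hu =>
    (iInf₂_le (T.linearIsometryEquiv u) (by simpa using hu)).trans (worstCaseMass_map_le δ P T u z)

theorem robustDepth_map (δ : ℝ) (P : Measure 𝔼) (T : 𝔼 ≃ᵃⁱ[ℝ] 𝔼) (z : 𝔼) :
    robustDepth δ (P.map T) (T z) = robustDepth δ P z := by
  refine le_antisymm (robustDepth_map_le δ P T z) ?_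
  have h := robustDepth_map_le δ (P.map T) T.symm (T z)
  rw [Measure.map_map T.symm.continuous.measurable T.continuous.measurable] at h
  have hid : (T.symm ∘ T : 𝔼 → 𝔼) = id := funext T.symm_apply_apply
  rwa [hid, Measure.map_id, T.symm_apply_apply] at h

theorem exists_affineIsometryEquiv (A : Matrix (Fin d) (Fin d) ℝ) (b : 𝔼)
    (hA : A * A.transpose = 1) :
    ∃ T : 𝔼 ≃ᵃⁱ[ℝ] 𝔼, (T : 𝔼 → 𝔼) = fun x => Matrix.toEuclideanLin A x + b := by
  -- Preserving norms needs `AᵀA = 1`; for square matrices a right inverse is also a left inverse.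
  have hA' : A.transpose * A = 1 := mul_eq_one_comm.mp hA
  have hnorm (x : 𝔼) : ‖Matrix.toEuclideanLin A x‖ = ‖x‖ := by
    rw [← sq_eq_sq₀ (norm_nonneg _) (norm_nonneg _), ← real_inner_self_eq_norm_sq,
      ← real_inner_self_eq_norm_sq, ← LinearMap.adjoint_inner_left,
      ← Matrix.toEuclideanLin_conjTranspose_eq_adjoint, Matrix.conjTranspose_eq_transpose_of_trivial]
    congr 1
    simp [Matrix.toEuclideanLin, Matrix.toLpLin_apply, Matrix.mulVec_mulVec, hA']
  let L : 𝔼 ≃ₗᵢ[ℝ] 𝔼 :=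
    LinearIsometry.toLinearIsometryEquiv ⟨Matrix.toEuclideanLin A, hnorm⟩ rfl
  refine ⟨L.toAffineIsometryEquiv.trans (AffineIsometryEquiv.vaddConst ℝ b), ?_⟩
  funext x
  rfl

theorem worstCaseMass_le_tail (δ : ℝ) (P : Measure 𝔼) (z : 𝔼) (hz : z ≠ 0) :
    worstCaseMass δ P (‖z‖⁻¹ • z) z ≤
      P {y | ‖z‖ / 2 ≤ ‖y‖} + ENNReal.ofReal δ / ENNReal.ofReal (‖z‖ / 2) := by
  have hz' : 0 < ‖z‖ := norm_pos_iff.mpr hz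
  have hr0 : ENNReal.ofReal (‖z‖ / 2) ≠ 0 := by simpa using hz
  refine iSup₂_le fun P' hP' => ?_
  have key : (P' : Measure 𝔼) (closedHalfspace (‖z‖⁻¹ • z) z) ≤
      P {y | ‖z‖ / 2 ≤ ‖y‖} + wassersteinDist (P' : Measure 𝔼) P / ENNReal.ofReal (‖z‖ / 2) := by
    -- Pulling the infimum outside reduces the bound to one for each coupling, so no optimal
    -- coupling is needed.
    simp only [wassersteinDist, ENNReal.iInf_div_of_ne hr0 ENNReal.ofReal_ne_top, ENNReal.add_iInf]
    refine le_iInf₂ fun Q hQ => ?_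
    have hsub : Prod.fst ⁻¹' closedHalfspace (‖z‖⁻¹ • z) z ⊆
        Prod.snd ⁻¹' {y : 𝔼 | ‖z‖ / 2 ≤ ‖y‖} ∪
        {p : 𝔼 × 𝔼 | ENNReal.ofReal (‖z‖ / 2) ≤ ENNReal.ofReal ‖p.1 - p.2‖} := by
      rintro ⟨x, y⟩ hx
      have hx' : 0 ≤ inner ℝ (‖z‖⁻¹ • z) (x - z) := hx
      rw [real_inner_smul_left] at hx'
      have h1 : 0 ≤ inner ℝ z (x - z) := nonneg_of_mul_nonneg_right hx' (inv_pos.mpr hz')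
      rw [inner_sub_right, real_inner_self_eq_norm_sq] at h1
      -- Cauchy–Schwarz: `‖z‖² ≤ ⟨z, x⟩ ≤ ‖z‖ ‖x‖`.
      have h2 : ‖z‖ ≤ ‖x‖ := by nlinarith [real_inner_le_norm z x]
      have h3 : ‖x‖ ≤ ‖x - y‖ + ‖y‖ := norm_le_norm_sub_add x y
      by_cases hy : ‖z‖ / 2 ≤ ‖y‖
      · exact Or.inl hy
      · exact Or.inr (ENNReal.ofReal_le_ofReal (by dsimp only; linarith))
    rw [← hQ.1, ← hQ.2, Measure.map_apply measurable_fst (measurableSet_closedHalfspace _ _),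
      Measure.map_apply measurable_snd (measurableSet_le measurable_const measurable_norm)]
    refine (measure_mono hsub).trans ((measure_union_le _ _).trans ?_)
    gcongr
    exact meas_ge_le_lintegral_div (by fun_prop) hr0 ENNReal.ofReal_ne_top
  exact key.trans (by gcongr)

theorem tendsto_robustDepth_cobounded (δ : ℝ) (P : Measure 𝔼) [IsFiniteMeasure P] :
    Tendsto (fun z => robustDepth δ P z) (Bornology.cobounded 𝔼) (𝓝 0) := by
  have hhalf : Tendsto (fun z : 𝔼 => ‖z‖ / 2) (Bornology.cobounded 𝔼) atTop :=
    tendsto_norm_cobounded_atTop.atTop_div_const two_pos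
  have htail : Tendsto (fun r : ℝ => P {y | r ≤ ‖y‖}) atTop (𝓝 0) := by
    have h := tendsto_measure_iInter_atTop (μ := P) (s := fun r : ℝ => {y : 𝔼 | r ≤ ‖y‖})
      (fun r => (measurableSet_le measurable_const measurable_norm).nullMeasurableSet)
      (fun r s hrs y hy => le_trans hrs hy) ⟨0, measure_ne_top _ _⟩
    have hempty : ⋂ r : ℝ, {y : 𝔼 | r ≤ ‖y‖} = ∅ := by
      refine Set.eq_empty_of_forall_notMem fun y hy => ?_
      have h1 : ‖y‖ + 1 ≤ ‖y‖ := Set.mem_iInter.mp hy (‖y‖ + 1)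
      linarith
    rwa [hempty, measure_empty] at h
  have hmarkov : Tendsto (fun r : ℝ => ENNReal.ofReal δ / ENNReal.ofReal r) atTop (𝓝 0) :=
    ENNReal.Tendsto.const_div ENNReal.tendsto_ofReal_atTop (Or.inr ENNReal.ofReal_ne_top)
      |>.trans (by simp)
  have hbound := (htail.add hmarkov).comp hhalf
  rw [add_zero] at hbound
  refine tendsto_of_tendsto_of_tendsto_of_le_of_le' tendsto_const_nhds hbound
    (Eventually.of_forall fun _ => zero_le) ?_
  filter_upwards [hhalf.eventually_gt_atTop 0] with z hz
  have hz0 : z ≠ 0 := norm_pos_iff.mp (by linarith)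
  exact (iInf₂_le (‖z‖⁻¹ • z) (norm_smul_inv_norm (𝕜 := ℝ) hz0)).trans (worstCaseMass_le_tail δ P z hz0)

/-- Raising `⟨u, z⟩` shrinks the halfspace, while the set of admissible `P'` does not depend on `z`.
-/
theorem worstCaseMass_anti (δ : ℝ) (P : Measure 𝔼) {u z w : 𝔼}
    (h : inner ℝ u z ≤ inner ℝ u w) : worstCaseMass δ P u w ≤ worstCaseMass δ P u z := by
  refine iSup₂_mono fun P' _ => measure_mono fun x hx => ?_
  have hx' : 0 ≤ inner ℝ u (x - w) := hx
  show 0 ≤ inner ℝ u (x - z)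
  rw [inner_sub_right] at hx' ⊢
  linarith

theorem convex_setOf_le_robustDepth (δ : ℝ) (P : Measure 𝔼) (c : ℝ≥0∞) :
    Convex ℝ {z : 𝔼 | c ≤ robustDepth δ P z} := by
  intro x hx y hy s t hs ht hst
  change c ≤ robustDepth δ P (s • x + t • y)
  refine le_iInf₂ fun u hu => ?_
  have hx' : c ≤ worstCaseMass δ P u x := le_trans hx (iInf₂_le u hu)
  have hy' : c ≤ worstCaseMass δ P u y := le_trans hy (iInf₂_le u hu)
  have hcomb : inner ℝ u (s • x + t • y) = s * inner ℝ u x + t * inner ℝ u y := by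
    rw [inner_add_right, real_inner_smul_right, real_inner_smul_right]
  have hmax : inner ℝ u (s • x + t • y) ≤ max (inner ℝ u x) (inner ℝ u y) :=
    hcomb.trans_le (Convex.combo_le_max _ _ hs ht hst)
  rcases le_max_iff.mp hmax with h | h
  · exact hx'.trans (worstCaseMass_anti δ P h)
  · exact hy'.trans (worstCaseMass_anti δ P h)

end Wasserstein

theorem mainTheorem3 (d : ℕ) (hd : 1 ≤ d) (δ : ℝ) (hδ : 0 < δ)
    (P : Measure (EuclideanSpace ℝ (Fin d))) [IsProbabilityMeasure P] :
    -- isometric invariance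
    (∀ (A : Matrix (Fin d) (Fin d) ℝ) (b z : EuclideanSpace ℝ (Fin d)), A * A.transpose = 1 →
      robustDepth δ (P.map (fun x => Matrix.toEuclideanLin A x + b))
        (Matrix.toEuclideanLin A z + b) = robustDepth δ P z) ∧
    -- null at infinity
    Tendsto (fun z => robustDepth δ P z)
      (Bornology.cobounded (EuclideanSpace ℝ (Fin d))) (𝓝 0) ∧
    -- convex upper level sets
    (∀ α : ℝ, 0 < α → α ≤ 1 →
      Convex ℝ {z : EuclideanSpace ℝ (Fin d) | ENNReal.ofReal α ≤ robustDepth δ P z}) := by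

  refine ⟨fun A b z hA => ?_, tendsto_robustDepth_cobounded δ P,
    fun α _ _ => convex_setOf_le_robustDepth δ P (ENNReal.ofReal α)⟩
  obtain ⟨T, hT⟩ := exists_affineIsometryEquiv A b hA
  have h := robustDepth_map δ P T z
  rwa [hT] at h
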